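/- For positive integers $s_1,\dots,s_d$ with $s_1>1$ let $$\zeta(s_1,\dots,s_d)=\sum_{k_1>\dots>k_d>0}\frac{1}{k_1^{s_1}\cdots k_d^{s_d}},\qquad G_d(x_1,\dots,x_d)=\sum_{\substack{s_1,\dots,s_d\ge 1\\ s_1>1}}x_1^{s_1-1}\cdots x_d^{s_d-1}\,\zeta(s_1,\dots,s_d).$$ (i) Let $x_1,x_2,x_3$ be complex numbers with $|x_1|<2$, $|x_2|<1$, $|x_3|<1$, and write $x_{ij}=x_i+x_j$. Then all series below converge absolutely, and if moreover $x_1,x_2,x_3$ are nonzero, $x_3\ne x_1$ and $x_3\neq x_2$, then $$\begin{aligned} &G_3(x_{13},x_1,x_2)-G_3(x_1,x_1,x_2)+G_3(x_{13},x_{23},x_2)-G_3(x_3,x_{23},x_2)-G_3(x_1,x_2,x_2)\\ &\quad+G_3(x_{13},x_{23},x_3)-G_3(x_3,x_{23},x_3)-G_3(x_1,x_2,x_3)-G_3(x_1,x_3,x_2)-G_3(x_3,x_1,x_2)\\ &=\frac{G_2(x_3,x_2)-G_2(x_1,x_2)}{x_3-x_1}+\frac{G_2(x_1,x_3)-G_2(x_1,x_2)}{x_3-x_2}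 -\frac{G_2(x_1,x_2)}{x_1}-\frac{G_2(x_3,x_2)}{x_3}-\frac{G_2(x_1,x_2)}{x_2}\\ &\quad-\sum_{s_1\ge2,\,s_2\ge1}x_1^{s_1-1}x_2^{s_2-1}\zeta(s_1,1,s_2)+\sum_{s\ge1}x_2^{s-1}\zeta(2,s)+\frac1{x_2}\sum_{s\ge2}x_1^{s-1}\zeta(s,1). \end{aligned}$$ (ii) Let $a,b,c$ be real numbers with $c\ne a$, $c\neq b$, and let $n\ge3$ be an integer. Then $$\begin{aligned} &\sum_{\substack{j\ge2,\,k,l\ge1\\ j+k+l=n}}\Big[(a+c)^{j-1}a^kb^lc+a(a+c)^{j-1}(b+c)^{k-1}(cb^l+bc^l)-a^{j+k-1}b^lc-a^jb^{k+l-1}c\\ &\qquad\qquad-ac^j(b+c)^{k-1}(b^l+bc^{l-1})-a^jb^kc^l-a^jc^kb^l-c^ja^kb^l\Big]\zeta(j,k,l)\\ &=\sum_{\substack{j\ge2,\,k\ge1\\ j+k=n}}\Big[\frac{(ac^j-a^jc)b^k}{c-a}+\frac{a^j(bc^k-b^kc)}{c-b}-a^{j-1}b^kc-ab^kc^{j-1}-a^jb^{k-1}c\Big]\zeta(j,k)\\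 &\quad-\sum_{k=2}^{n-2}a^kb^{n-1-k}c\,\zeta(k,1,n-1-k)+ab^{n-2}c\,\zeta(2,n-2)+a^{n-1}c\,\zeta(n-1,1). \end{aligned}$$ Here $0^0=1$. -/

import Mathlib

open scoped BigOperators

noncomputable section

/-- Summation indices `k₁ > k₂ > ⋯ > k_d > 0` of a multiple zeta value of depth `d`. -/
def MZVIndex (d : ℕ) : Type :=
  {k : Fin d → ℕ // StrictAnti k ∧ ∀ i, 0 < k i}

/-- The multiple zeta value
`ζ(s₁, …, s_d) = ∑_{k₁ > ⋯ > k_d > 0} 1 / (k₁ ^ s₁ ⋯ k_d ^ s_d)`;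
it is used only for positive integers `s₁, …, s_d` with `s₁ > 1`. -/
def multiZeta {d : ℕ} (s : Fin d → ℕ) : ℝ :=
  ∑' k : MZVIndex d, 1 / ∏ i, (k.1 i : ℝ) ^ s i

/-- Exponents `(s₁, …, s_d)` of positive integers with `s₁ > 1`. -/
def AdmissibleExponent (d : ℕ) [NeZero d] : Type :=
  {s : Fin d → ℕ // (∀ i, 1 ≤ s i) ∧ 1 < s 0}

/-- The general term `x₁ ^ (s₁ - 1) ⋯ x_d ^ (s_d - 1) ζ(s₁, …, s_d)` of the generating
function of the multiple zeta values of depth `d`. -/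
def genTerm {d : ℕ} [NeZero d] (x : Fin d → ℂ) (s : AdmissibleExponent d) : ℂ :=
  (∏ i, x i ^ (s.1 i - 1)) * (multiZeta s.1 : ℂ)

/-- The generating function `G_d(x₁, …, x_d)` of the multiple zeta values of depth `d`. -/
def genG {d : ℕ} [NeZero d] (x : Fin d → ℂ) : ℂ :=
  ∑' s : AdmissibleExponent d, genTerm x s

/-- The general term of `∑_{s₁ ≥ 2, s₂ ≥ 1} x ^ (s₁ - 1) y ^ (s₂ - 1) ζ(s₁, 1, s₂)`. -/
def middleOneTerm (x y : ℂ) (s : {s : ℕ × ℕ // 2 ≤ s.1 ∧ 1 ≤ s.2}) : ℂ :=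
  x ^ (s.1.1 - 1) * y ^ (s.1.2 - 1) * (multiZeta ![s.1.1, 1, s.1.2] : ℂ)

/-- The general term of `∑_{s ≥ 1} x ^ (s - 1) ζ(2, s)`. -/
def firstTwoTerm (x : ℂ) (s : {s : ℕ // 1 ≤ s}) : ℂ :=
  x ^ (s.1 - 1) * (multiZeta ![2, s.1] : ℂ)

/-- The general term of `∑_{s ≥ 2} x ^ (s - 1) ζ(s, 1)`. -/
def lastOneTerm (x : ℂ) (s : {s : ℕ // 2 ≤ s}) : ℂ :=
  x ^ (s.1 - 1) * (multiZeta ![s.1, 1] : ℂ)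

/-- Pairs `(j, k)` with `j ≥ 2`, `k ≥ 1` and `j + k = n`. -/
def weightPairs (n : ℕ) : Finset (ℕ × ℕ) :=
  (Finset.Icc 2 n ×ˢ Finset.Icc 1 n).filter fun p => p.1 + p.2 = n

/-- Triples `(j, k, l)` with `j ≥ 2`, `k, l ≥ 1` and `j + k + l = n`. -/
def weightTriples (n : ℕ) : Finset (ℕ × ℕ × ℕ) :=
  (Finset.Icc 2 n ×ˢ Finset.Icc 1 n ×ˢ Finset.Icc 1 n).filter
    fun p => p.1 + p.2.1 + p.2.2 = n

end

/-! ### Summability of the dominating series -/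

/-! Summing geometric series inside the generating function gives `G_d(x) = x₁ * ∑ 1 / (k₁ (k₁ - x₁)
(k₂ - x₂) ⋯)` over `k₁ > ⋯ > k_d > 0`; these sums are `sumTwo` and `sumThree`, with the factor `x₁`
removed. The identity is a double shuffle relation: the product of `∑ (1/(m - x₃) - 1/m)` and `∑
(1/(k₁ - x₁) - 1/k₁) / (k₂ - x₂)` is computed in two ways. The subtracted terms `1/m` and `1/k₁`
regularise the factors, so every series involved converges absolutely.

Partial fractions `1/(pq) = (1/p + 1/q)/(p + q)` turn the product into depth-three sums
(`hasSum_productTerm_shuffle`). Sorting by the position of `m` relative to `k₁ > k₂` gives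
depth-three sums plus depth-two sums from `m = k₁` and `m = k₂` (`hasSum_productTerm_stuffle`).
Equating the two yields `sumThree_double_shuffle`.

That relation has no denominators `x₁`, `x₂`, `x₃`. Dividing by `x₂` gives (i). For (ii), put `(x₁,
x₂, x₃) = (ta, tb, tc)`, multiply by `ta * tc` and compare coefficients of powers of `t`; vanishing
`a`, `b` or `c` needs no separate treatment. -/

lemma summable_one_div_succ_rpow :
    Summable fun n : ℕ => 1 / ((n : ℝ) + 1) ^ (4 / 3 : ℝ) := by
  have h := (Real.summable_one_div_nat_add_rpow 1 (4 / 3)).2 (by norm_num)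
  refine h.congr fun n => ?_
  rw [abs_of_pos (by positivity)]

lemma Summable.mul_mul_of_nonneg {u : ℕ → ℝ} (hu : Summable u) (h0 : 0 ≤ u) :
    Summable fun p : ℕ × ℕ × ℕ => u p.1 * (u p.2.1 * u p.2.2) :=
  Summable.mul_of_nonneg (g := fun q : ℕ × ℕ => u q.1 * u q.2) hu
    (hu.mul_of_nonneg hu h0 h0) h0 (fun p => mul_nonneg (h0 p.1) (h0 p.2))

lemma HasSum.of_forall_eq {ι : Type*} {f g : ι → ℂ} {a : ℂ} (h : HasSum f a)
    (hfg : ∀ i, g i = f i) : HasSum g a := by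
  rwa [funext hfg]

lemma rpow_third_facts {a k : ℝ} (ha : 0 ≤ a) (hk : a ≤ k) :
    a ^ (1 / 3 : ℝ) ≤ k ^ (1 / 3 : ℝ) ∧ (a ^ (1 / 3 : ℝ)) ^ 3 = a ∧
      a ^ (4 / 3 : ℝ) = (a ^ (1 / 3 : ℝ)) ^ 4 := by
  refine ⟨Real.rpow_le_rpow ha hk (by norm_num), ?_, ?_⟩
  · rw [← Real.rpow_natCast, ← Real.rpow_mul ha]; norm_num
  · rw [← Real.rpow_natCast, ← Real.rpow_mul ha]; norm_num

lemma rpow_mul_rpow_le_sq_mul {a b k l : ℝ} (ha : 0 ≤ a) (hb : 0 ≤ b)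
    (hak : a ≤ k) (hbl : b ≤ l) (hlk : l ≤ k) :
    a ^ (4 / 3 : ℝ) * b ^ (4 / 3 : ℝ) ≤ (k ^ (1 / 3 : ℝ)) ^ 5 * l := by
  have hl := hb.trans hbl
  have hk := ha.trans hak
  obtain ⟨h1, -, h3⟩ := rpow_third_facts ha hak
  obtain ⟨h4, -, h6⟩ := rpow_third_facts hb hbl
  obtain ⟨h7, h8, -⟩ := rpow_third_facts hl hlk
  rw [h3, h6, ← h8]
  have := Real.rpow_nonneg ha (1 / 3)
  have := Real.rpow_nonneg hb (1 / 3)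
  have := Real.rpow_nonneg hk (1 / 3)
  have := Real.rpow_nonneg hl (1 / 3)
  calc (a ^ (1 / 3 : ℝ)) ^ 4 * (b ^ (1 / 3 : ℝ)) ^ 4
      ≤ (k ^ (1 / 3 : ℝ)) ^ 4 * (l ^ (1 / 3 : ℝ)) ^ 4 := by gcongr
    _ = ((k ^ (1 / 3 : ℝ)) ^ 4 * (l ^ (1 / 3 : ℝ)) ^ 3) * l ^ (1 / 3 : ℝ) := by ring
    _ ≤ ((k ^ (1 / 3 : ℝ)) ^ 4 * (l ^ (1 / 3 : ℝ)) ^ 3) * k ^ (1 / 3 : ℝ) := by gcongr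
    _ = _ := by ring

/-- The total exponent `2 + 1 + 1 = 4` is spread evenly as three times `4/3`: since `k` is the
largest, a third of a power of `l` and of `m` can be traded for powers of `k`. With `a`, `b`, `c`
the gaps, the multiple series is dominated by a product of three convergent series. -/
lemma rpow_mul_rpow_mul_rpow_le {a b c k l m : ℝ} (ha : 0 ≤ a) (hb : 0 ≤ b) (hc : 0 ≤ c)
    (hak : a ≤ k) (hbl : b ≤ l) (hcm : c ≤ m) (hlk : l ≤ k) (hml : m ≤ l) :
    a ^ (4 / 3 : ℝ) * (b ^ (4 / 3 : ℝ) * c ^ (4 / 3 : ℝ)) ≤ k ^ 2 * l * m := by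
  have hk := ha.trans hak
  have hl := hb.trans hbl
  have hm := hc.trans hcm
  have h := rpow_mul_rpow_le_sq_mul ha hb hak hbl hlk
  obtain ⟨-, h2, -⟩ := rpow_third_facts hk le_rfl
  obtain ⟨h4, -, h6⟩ := rpow_third_facts hc hcm
  obtain ⟨h7, h8, -⟩ := rpow_third_facts hm (hml.trans hlk)
  have := Real.rpow_nonneg hc (1 / 3)
  have := Real.rpow_nonneg hk (1 / 3)
  have := Real.rpow_nonneg hm (1 / 3)
  calc a ^ (4 / 3 : ℝ) * (b ^ (4 / 3 : ℝ) * c ^ (4 / 3 : ℝ))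
      = a ^ (4 / 3 : ℝ) * b ^ (4 / 3 : ℝ) * c ^ (4 / 3 : ℝ) := by ring
    _ ≤ (k ^ (1 / 3 : ℝ)) ^ 5 * l * ((m ^ (1 / 3 : ℝ)) ^ 3 * k ^ (1 / 3 : ℝ)) := by
        rw [h6]
        gcongr
        calc (c ^ (1 / 3 : ℝ)) ^ 4 ≤ (m ^ (1 / 3 : ℝ)) ^ 4 := by gcongr
          _ = (m ^ (1 / 3 : ℝ)) ^ 3 * m ^ (1 / 3 : ℝ) := by ring
          _ ≤ _ := by gcongr
    _ = ((k ^ (1 / 3 : ℝ)) ^ 3) ^ 2 * l * m := by rw [h8]; ring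
    _ = _ := by rw [h2]

/-! ### Expansion into geometric series -/

/-- Fubini: because `r` does not depend on `k`, the double series is dominated by the product of two
summable families. -/
lemma exists_hasSum_swap {ι K : Type*} {W : K → ℂ} {g : K → ι → ℂ} {r : ι → ℝ}
    (hr : Summable r) (hW : Summable fun k => ‖W k‖) (hg : ∀ k i, ‖g k i‖ ≤ r i) :
    ∃ S, HasSum (fun k => W k * ∑' i, g k i) S ∧ HasSum (fun i => ∑' k, W k * g k i) S := by
  rcases isEmpty_or_nonempty K with hK | ⟨⟨k₀⟩⟩
  · exact ⟨0, hasSum_empty, by simp⟩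
  have hr0 : 0 ≤ r := fun i => (norm_nonneg _).trans (hg k₀ i)
  have hs : Summable fun p : K × ι => W p.1 * g p.1 p.2 := by
    refine Summable.of_norm_bounded (hW.mul_of_nonneg hr (fun _ => norm_nonneg _) hr0) fun p => ?_
    rw [norm_mul]
    gcongr
    exact hg _ _
  refine ⟨_, hs.hasSum.prod_fiberwise fun k => ?_, ?_⟩
  · exact (Summable.of_norm_bounded hr (hg k)).hasSum.mul_left (W k)
  · have hc := (Equiv.prodComm ι K).hasSum_iff.2 hs.hasSum
    exact hc.prod_fiberwise fun i => (hc.summable.prod_factor i).hasSum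

lemma hasSum_geometric_mul {u v : ℂ} (hu : ‖u‖ < 1) (hv : ‖v‖ < 1) :
    HasSum (fun p : ℕ × ℕ => u ^ p.1 * v ^ p.2) ((1 - u)⁻¹ * (1 - v)⁻¹) ∧
      Summable fun p : ℕ × ℕ => ‖u ^ p.1 * v ^ p.2‖ := by
  have geo : ∀ {t : ℂ}, ‖t‖ < 1 → Summable fun n : ℕ => ‖t ^ n‖ := fun ht => by
    simpa using summable_geometric_of_lt_one (norm_nonneg _) ht
  exact ⟨(hasSum_geometric_of_norm_lt_one hu).mul (hasSum_geometric_of_norm_lt_one hv)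
    (summable_mul_of_summable_norm (geo hu) (geo hv)), Summable.mul_norm (geo hu) (geo hv)⟩

lemma exists_hasSum_geometric_two {K : Type*} {W u v : K → ℂ} {ρ : ℝ} (hρ0 : 0 ≤ ρ) (hρ : ρ < 1)
    (hW : Summable fun k => ‖W k‖) (hu : ∀ k, ‖u k‖ ≤ ρ) (hv : ∀ k, ‖v k‖ ≤ ρ) :
    ∃ S, HasSum (fun k => W k * ((1 - u k)⁻¹ * (1 - v k)⁻¹)) S ∧
      HasSum (fun p : ℕ × ℕ => ∑' k, W k * (u k ^ p.1 * v k ^ p.2)) S := by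
  have hg := summable_geometric_of_lt_one hρ0 hρ
  have hg0 : (0 : ℕ → ℝ) ≤ fun n => ρ ^ n := fun n => by positivity
  obtain ⟨S, h1, h2⟩ := exists_hasSum_swap
    (g := fun k (p : ℕ × ℕ) => u k ^ p.1 * v k ^ p.2) (hg.mul_of_nonneg hg hg0 hg0) hW
    (fun k p => by
      rw [norm_mul, norm_pow, norm_pow]
      gcongr
      exacts [hu k, hv k])
  refine ⟨S, ?_, h2⟩
  convert h1 using 3 with k
  exact (hasSum_geometric_mul ((hu k).trans_lt hρ) ((hv k).trans_lt hρ)).1.tsum_eq.symm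

lemma exists_hasSum_geometric_three {K : Type*} {W u v w : K → ℂ} {ρ : ℝ} (hρ0 : 0 ≤ ρ)
    (hρ : ρ < 1) (hW : Summable fun k => ‖W k‖) (hu : ∀ k, ‖u k‖ ≤ ρ) (hv : ∀ k, ‖v k‖ ≤ ρ)
    (hw : ∀ k, ‖w k‖ ≤ ρ) :
    ∃ S, HasSum (fun k => W k * ((1 - u k)⁻¹ * ((1 - v k)⁻¹ * (1 - w k)⁻¹))) S ∧
      HasSum (fun p : ℕ × ℕ × ℕ =>
        ∑' k, W k * (u k ^ p.1 * (v k ^ p.2.1 * w k ^ p.2.2))) S := by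
  have hg := summable_geometric_of_lt_one hρ0 hρ
  have hg0 : (0 : ℕ → ℝ) ≤ fun n => ρ ^ n := fun n => by positivity
  have hr := hg.mul_mul_of_nonneg hg0
  obtain ⟨S, h1, h2⟩ := exists_hasSum_swap
    (g := fun k (p : ℕ × ℕ × ℕ) => u k ^ p.1 * (v k ^ p.2.1 * w k ^ p.2.2)) hr hW
    (fun k p => by
      rw [norm_mul, norm_mul, norm_pow, norm_pow, norm_pow]
      gcongr
      exacts [hu k, hv k, hw k])
  refine ⟨S, ?_, h2⟩
  convert h1 using 3 with k
  have h := hasSum_geometric_mul ((hv k).trans_lt hρ) ((hw k).trans_lt hρ)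
  have hk := (hu k).trans_lt hρ
  have hn : Summable fun n : ℕ => ‖u k ^ n‖ := by
    simpa using summable_geometric_of_lt_one (norm_nonneg _) hk
  have hp := summable_mul_of_summable_norm hn h.2
  exact ((hasSum_geometric_of_norm_lt_one hk).mul h.1 hp).tsum_eq.symm

/-! ### Coordinates on the index sets -/

/-- The gaps of `k₁ > k₂ > 0` as coordinates. -/
def mzvIndexTwo : ℕ × ℕ ≃ MZVIndex 2 where
  toFun k := ⟨![k.1 + k.2 + 2, k.2 + 1], by
    refine ⟨Fin.strictAnti_iff_succ_lt.2 fun i => ?_, fun i => ?_⟩ <;> fin_cases i <;> simp⟩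
  invFun k := (k.1 0 - k.1 1 - 1, k.1 1 - 1)
  left_inv k := by
    ext
    · simp
      omega
    · simp
  right_inv k := by
    have h1 : k.1 1 < k.1 0 := k.2.1 (by decide)
    have h2 := k.2.2 1
    apply Subtype.ext
    funext i
    fin_cases i <;> simp <;> omega

/-- The gaps of `k₁ > k₂ > k₃ > 0` as coordinates. -/
def mzvIndexThree : ℕ × ℕ × ℕ ≃ MZVIndex 3 where
  toFun k := ⟨![k.1 + k.2.1 + k.2.2 + 3, k.2.1 + k.2.2 + 2, k.2.2 + 1], by
    refine ⟨Fin.strictAnti_iff_succ_lt.2 fun i => ?_, fun i => ?_⟩ <;> fin_cases i <;> simp⟩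
  invFun k := (k.1 0 - k.1 1 - 1, k.1 1 - k.1 2 - 1, k.1 2 - 1)
  left_inv k := by ext <;> simp <;> omega
  right_inv k := by
    have h1 : k.1 1 < k.1 0 := k.2.1 (by decide)
    have h2 : k.1 2 < k.1 1 := k.2.1 (by decide)
    have h3 := k.2.2 2
    apply Subtype.ext
    funext i
    fin_cases i <;> simp <;> omega

/-- Admissible exponents of depth two as shifted pairs. -/
def admissibleExponentTwo : ℕ × ℕ ≃ AdmissibleExponent 2 where
  toFun p := ⟨![p.1 + 2, p.2 + 1], by
    refine ⟨fun i => ?_, ?_⟩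
    · fin_cases i <;> simp
    · simp⟩
  invFun s := (s.1 0 - 2, s.1 1 - 1)
  left_inv p := by ext <;> simp
  right_inv s := by
    have h0 := s.2.2
    have h1 := s.2.1 1
    apply Subtype.ext
    funext i
    fin_cases i <;> simp <;> omega

/-- Admissible exponents of depth three as shifted triples. -/
def admissibleExponentThree : ℕ × ℕ × ℕ ≃ AdmissibleExponent 3 where
  toFun p := ⟨![p.1 + 2, p.2.1 + 1, p.2.2 + 1], by
    refine ⟨fun i => ?_, ?_⟩
    · fin_cases i <;> simp
    · simp⟩
  invFun s := (s.1 0 - 2, s.1 1 - 1, s.1 2 - 1)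
  left_inv p := by ext <;> simp
  right_inv s := by
    have h0 := s.2.2
    have h1 := s.2.1 1
    have h2 := s.2.1 2
    apply Subtype.ext
    funext i
    fin_cases i <;> simp <;> omega

lemma multiZeta_two (s t : ℕ) : (multiZeta ![s, t] : ℂ) =
    ∑' k : ℕ × ℕ, 1 / (((k.1 : ℂ) + k.2 + 2) ^ s * ((k.2 : ℂ) + 1) ^ t) := by
  rw [multiZeta, ← mzvIndexTwo.tsum_eq, Complex.ofReal_tsum]
  refine tsum_congr fun k => ?_
  have h : (mzvIndexTwo k).1 = ![k.1 + k.2 + 2, k.2 + 1] := rfl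
  simp [h, Fin.prod_univ_two]

lemma multiZeta_three (s t r : ℕ) : (multiZeta ![s, t, r] : ℂ) =
    ∑' k : ℕ × ℕ × ℕ, 1 / (((k.1 : ℂ) + k.2.1 + k.2.2 + 3) ^ s *
      ((k.2.1 : ℂ) + k.2.2 + 2) ^ t * ((k.2.2 : ℂ) + 1) ^ r) := by
  rw [multiZeta, ← mzvIndexThree.tsum_eq, Complex.ofReal_tsum]
  refine tsum_congr fun k => ?_
  have h : (mzvIndexThree k).1 =
      ![k.1 + k.2.1 + k.2.2 + 3, k.2.1 + k.2.2 + 2, k.2.2 + 1] := rfl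
  simp [h, Fin.prod_univ_three]

/-! ### The kernels of the generating functions -/

noncomputable section

/-- `1 / (k₁ (k₁ - x) (k₂ - y))` in the gap coordinates of `k₁ > k₂ > 0`. -/
def kernelTwo (x y : ℂ) (k : ℕ × ℕ) : ℂ :=
  1 / (((k.1 : ℂ) + k.2 + 2) * ((k.1 : ℂ) + k.2 + 2 - x) * ((k.2 : ℂ) + 1 - y))

/-- `1 / (k₁ (k₁ - x) (k₂ - y) (k₃ - z))` in the gap coordinates of `k₁ > k₂ > k₃ > 0`. -/
def kernelThree (x y z : ℂ) (k : ℕ × ℕ × ℕ) : ℂ :=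
  1 / (((k.1 : ℂ) + k.2.1 + k.2.2 + 3) * ((k.1 : ℂ) + k.2.1 + k.2.2 + 3 - x) *
    ((k.2.1 : ℂ) + k.2.2 + 2 - y) * ((k.2.2 : ℂ) + 1 - z))

/-- The sum of `kernelTwo x y`; it equals `∑ x ^ (s₁ - 2) y ^ (s₂ - 1) ζ(s₁, s₂)`. -/
def sumTwo (x y : ℂ) : ℂ := ∑' k, kernelTwo x y k

/-- The sum of `kernelThree x y z`; it equals
`∑ x ^ (s₁ - 2) y ^ (s₂ - 1) z ^ (s₃ - 1) ζ(s₁, s₂, s₃)`. -/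
def sumThree (x y z : ℂ) : ℂ := ∑' k, kernelThree x y z k

end

lemma summable_kernelTwo_zero : Summable fun k : ℕ × ℕ =>
    ‖1 / (((k.1 : ℂ) + k.2 + 2) ^ 2 * ((k.2 : ℂ) + 1))‖ := by
  have hu := summable_one_div_succ_rpow
  have h0 : (0 : ℕ → ℝ) ≤ fun n : ℕ => 1 / ((n : ℝ) + 1) ^ (4 / 3 : ℝ) :=
    fun n => by positivity
  refine (hu.mul_of_nonneg hu h0 h0).of_nonneg_of_le (fun _ => norm_nonneg _) fun k => ?_
  have e : ‖1 / (((k.1 : ℂ) + k.2 + 2) ^ 2 * ((k.2 : ℂ) + 1))‖ =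
      1 / (((k.1 : ℝ) + k.2 + 2) ^ 2 * ((k.2 : ℝ) + 1) * 1) := by
    rw [show 1 / (((k.1 : ℂ) + k.2 + 2) ^ 2 * ((k.2 : ℂ) + 1)) =
      ((1 / (((k.1 : ℝ) + k.2 + 2) ^ 2 * ((k.2 : ℝ) + 1) * 1) : ℝ) : ℂ) by push_cast; ring]
    exact Complex.norm_of_nonneg (by positivity)
  have ha : (0 : ℝ) ≤ k.1 := by positivity
  have hb : (0 : ℝ) ≤ k.2 := by positivity
  -- Depth two is the case `c = m = 1` of the three-variable bound.
  have h := rpow_mul_rpow_mul_rpow_le (a := (k.1 : ℝ) + 1) (b := (k.2 : ℝ) + 1) (c := 1)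
    (k := (k.1 : ℝ) + k.2 + 2) (l := (k.2 : ℝ) + 1) (m := 1)
    (by positivity) (by positivity) (by positivity)
    (by linarith) (by linarith) le_rfl (by linarith) (by linarith)
  rw [Real.one_rpow, mul_one] at h
  rw [e, one_div_mul_one_div]
  exact one_div_le_one_div_of_le (by positivity) h

lemma summable_kernelThree_zero : Summable fun k : ℕ × ℕ × ℕ =>
    ‖1 / (((k.1 : ℂ) + k.2.1 + k.2.2 + 3) ^ 2 * ((k.2.1 : ℂ) + k.2.2 + 2) *
      ((k.2.2 : ℂ) + 1))‖ := by
  have hu := summable_one_div_succ_rpow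
  have h0 : (0 : ℕ → ℝ) ≤ fun n : ℕ => 1 / ((n : ℝ) + 1) ^ (4 / 3 : ℝ) :=
    fun n => by positivity
  have hr := hu.mul_mul_of_nonneg h0
  refine hr.of_nonneg_of_le (fun _ => norm_nonneg _) fun k => ?_
  have e : ‖1 / (((k.1 : ℂ) + k.2.1 + k.2.2 + 3) ^ 2 * ((k.2.1 : ℂ) + k.2.2 + 2) *
      ((k.2.2 : ℂ) + 1))‖ = 1 / (((k.1 : ℝ) + k.2.1 + k.2.2 + 3) ^ 2 *
        ((k.2.1 : ℝ) + k.2.2 + 2) * ((k.2.2 : ℝ) + 1)) := by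
    rw [show 1 / (((k.1 : ℂ) + k.2.1 + k.2.2 + 3) ^ 2 * ((k.2.1 : ℂ) + k.2.2 + 2) *
      ((k.2.2 : ℂ) + 1)) = ((1 / (((k.1 : ℝ) + k.2.1 + k.2.2 + 3) ^ 2 *
        ((k.2.1 : ℝ) + k.2.2 + 2) * ((k.2.2 : ℝ) + 1)) : ℝ) : ℂ) by push_cast; ring]
    exact Complex.norm_of_nonneg (by positivity)
  have ha : (0 : ℝ) ≤ k.1 := by positivity
  have hb : (0 : ℝ) ≤ k.2.1 := by positivity
  have hc : (0 : ℝ) ≤ k.2.2 := by positivity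
  have h := rpow_mul_rpow_mul_rpow_le (a := (k.1 : ℝ) + 1) (b := (k.2.1 : ℝ) + 1)
    (c := (k.2.2 : ℝ) + 1) (k := (k.1 : ℝ) + k.2.1 + k.2.2 + 3) (l := (k.2.1 : ℝ) + k.2.2 + 2)
    (m := (k.2.2 : ℝ) + 1) (by positivity) (by positivity) (by positivity)
    (by linarith) (by linarith) (by linarith) (by linarith) (by linarith)
  rw [e, one_div_mul_one_div, one_div_mul_one_div]
  exact one_div_le_one_div_of_le (by positivity) h

lemma norm_div_natCast_le {x : ℂ} {ρ : ℝ} {m n : ℕ} (hm : 0 < m) (hmn : m ≤ n)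
    (h : ‖x‖ / m ≤ ρ) : ‖x / (n : ℂ)‖ ≤ ρ := by
  rw [norm_div, Complex.norm_natCast]
  refine le_trans ?_ h
  have : (m : ℝ) ≤ n := by exact_mod_cast hmn
  have : (0 : ℝ) < m := by exact_mod_cast hm
  gcongr

lemma natCast_sub_ne_zero {x : ℂ} {n : ℕ} (h : ‖x‖ < n) : (n : ℂ) - x ≠ 0 := by
  intro h0
  rw [← sub_eq_zero.1 h0, Complex.norm_natCast] at h
  exact lt_irrefl _ h

/-- Expand `1/(k₁ - x)` and `1/(k₂ - y)` in powers of `x/k₁` and `y/k₂`, and sum over the indices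
first. -/
lemma hasSum_sumTwo {x y : ℂ} (hx : ‖x‖ < 2) (hy : ‖y‖ < 1) :
    HasSum (kernelTwo x y) (sumTwo x y) ∧
      HasSum (fun p : ℕ × ℕ => x ^ p.1 * y ^ p.2 * (multiZeta ![p.1 + 2, p.2 + 1] : ℂ))
        (sumTwo x y) := by
  obtain ⟨S, h1, h2⟩ := exists_hasSum_geometric_two
    (u := fun k : ℕ × ℕ => x / ((k.1 : ℂ) + k.2 + 2)) (v := fun k : ℕ × ℕ => y / ((k.2 : ℂ) + 1))
    (ρ := max (‖x‖ / 2) ‖y‖) (le_max_of_le_right (norm_nonneg _))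
    (max_lt (by linarith) hy) summable_kernelTwo_zero
    (fun k => by
      have := norm_div_natCast_le (x := x) (m := 2) (n := k.1 + k.2 + 2)
        (by norm_num) (by omega) (le_max_left (‖x‖ / 2) ‖y‖)
      push_cast at this
      exact this)
    (fun k => by
      have := norm_div_natCast_le (x := y) (ρ := max (‖x‖ / 2) ‖y‖) (m := 1)
        (n := k.2 + 1) (by norm_num) (by omega) (by
          rw [Nat.cast_one, div_one]
          exact le_max_right (‖x‖ / 2) ‖y‖)
      push_cast at this
      exact this)
  have h1' : HasSum (kernelTwo x y) S := by
    convert h1 using 2 with k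
    have a1 : ((k.1 : ℂ) + k.2 + 2) ≠ 0 := by exact_mod_cast Nat.succ_ne_zero (k.1 + k.2 + 1)
    have a2 : ((k.2 : ℂ) + 1) ≠ 0 := Nat.cast_add_one_ne_zero _
    rw [kernelTwo, one_sub_div a1, one_sub_div a2, inv_div, inv_div]
    field_simp
  have hS : S = sumTwo x y := h1'.tsum_eq.symm
  subst hS
  refine ⟨h1', ?_⟩
  convert h2 using 2 with p
  rw [multiZeta_two, ← tsum_mul_left]
  refine tsum_congr fun k => ?_
  have a1 : ((k.1 : ℂ) + k.2 + 2) ≠ 0 := by exact_mod_cast Nat.succ_ne_zero (k.1 + k.2 + 1)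
  have a2 : ((k.2 : ℂ) + 1) ≠ 0 := Nat.cast_add_one_ne_zero _
  rw [div_pow, div_pow]
  field_simp
  ring

lemma hasSum_sumThree {x y z : ℂ} (hx : ‖x‖ < 3) (hy : ‖y‖ < 2) (hz : ‖z‖ < 1) :
    HasSum (kernelThree x y z) (sumThree x y z) ∧
      HasSum (fun p : ℕ × ℕ × ℕ => x ^ p.1 * y ^ p.2.1 * z ^ p.2.2 *
        (multiZeta ![p.1 + 2, p.2.1 + 1, p.2.2 + 1] : ℂ)) (sumThree x y z) := by
  obtain ⟨S, h1, h2⟩ := exists_hasSum_geometric_three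
    (u := fun k : ℕ × ℕ × ℕ => x / ((k.1 : ℂ) + k.2.1 + k.2.2 + 3))
    (v := fun k : ℕ × ℕ × ℕ => y / ((k.2.1 : ℂ) + k.2.2 + 2))
    (w := fun k : ℕ × ℕ × ℕ => z / ((k.2.2 : ℂ) + 1))
    -- The indices satisfy `k₁ ≥ 3`, `k₂ ≥ 2`, `k₃ ≥ 1`. This enlarged polydisc is what admits the
    -- arguments `x₁ + x₃` and `x₂ + x₃`.
    (ρ := max (‖x‖ / 3) (max (‖y‖ / 2) ‖z‖))
    (le_max_of_le_right (le_max_of_le_right (norm_nonneg _)))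
    (max_lt (by linarith) (max_lt (by linarith) hz)) summable_kernelThree_zero
    (fun k => by
      have := norm_div_natCast_le (x := x) (m := 3) (n := k.1 + k.2.1 + k.2.2 + 3)
        (by norm_num) (by omega) (le_max_left (‖x‖ / 3) (max (‖y‖ / 2) ‖z‖))
      push_cast at this
      exact this)
    (fun k => by
      have := norm_div_natCast_le (x := y) (m := 2) (n := k.2.1 + k.2.2 + 2)
        (by norm_num) (by omega)
        ((le_max_left (‖y‖ / 2) ‖z‖).trans (le_max_right (‖x‖ / 3) (max (‖y‖ / 2) ‖z‖)))
      push_cast at this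
      exact this)
    (fun k => by
      have := norm_div_natCast_le (x := z) (ρ := max (‖x‖ / 3) (max (‖y‖ / 2) ‖z‖)) (m := 1)
        (n := k.2.2 + 1) (by norm_num) (by omega) (by
          rw [Nat.cast_one, div_one]
          exact (le_max_right (‖y‖ / 2) ‖z‖).trans (le_max_right _ _))
      push_cast at this
      exact this)
  have h1' : HasSum (kernelThree x y z) S := by
    convert h1 using 2 with k
    have a1 : ((k.1 : ℂ) + k.2.1 + k.2.2 + 3) ≠ 0 := by
      exact_mod_cast Nat.succ_ne_zero (k.1 + k.2.1 + k.2.2 + 2)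
    have a2 : ((k.2.1 : ℂ) + k.2.2 + 2) ≠ 0 := by
      exact_mod_cast Nat.succ_ne_zero (k.2.1 + k.2.2 + 1)
    have a3 : ((k.2.2 : ℂ) + 1) ≠ 0 := Nat.cast_add_one_ne_zero _
    rw [kernelThree, one_sub_div a1, one_sub_div a2, one_sub_div a3, inv_div, inv_div, inv_div]
    field_simp
  have hS : S = sumThree x y z := h1'.tsum_eq.symm
  subst hS
  refine ⟨h1', ?_⟩
  convert h2 using 2 with p
  rw [multiZeta_three, ← tsum_mul_left]
  refine tsum_congr fun k => ?_
  have a1 : ((k.1 : ℂ) + k.2.1 + k.2.2 + 3) ≠ 0 := by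
      exact_mod_cast Nat.succ_ne_zero (k.1 + k.2.1 + k.2.2 + 2)
  have a2 : ((k.2.1 : ℂ) + k.2.2 + 2) ≠ 0 := by
      exact_mod_cast Nat.succ_ne_zero (k.2.1 + k.2.2 + 1)
  have a3 : ((k.2.2 : ℂ) + 1) ≠ 0 := Nat.cast_add_one_ne_zero _
  rw [div_pow, div_pow, div_pow]
  field_simp
  ring

/-! ### Generating series as kernel sums -/

lemma hasSum_genTerm_two {x y : ℂ} (hx : ‖x‖ < 2) (hy : ‖y‖ < 1) :
    HasSum (genTerm ![x, y]) (x * sumTwo x y) := by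
  rw [← admissibleExponentTwo.hasSum_iff]
  refine ((hasSum_sumTwo hx hy).2.mul_left x).of_forall_eq fun p => ?_
  have h : (admissibleExponentTwo p).1 = ![p.1 + 2, p.2 + 1] := rfl
  simp [genTerm, h, Fin.prod_univ_two, pow_succ]
  ring

lemma hasSum_genTerm_three {x y z : ℂ} (hx : ‖x‖ < 3) (hy : ‖y‖ < 2) (hz : ‖z‖ < 1) :
    HasSum (genTerm ![x, y, z]) (x * sumThree x y z) := by
  rw [← admissibleExponentThree.hasSum_iff]
  refine ((hasSum_sumThree hx hy hz).2.mul_left x).of_forall_eq fun p => ?_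
  have h : (admissibleExponentThree p).1 = ![p.1 + 2, p.2.1 + 1, p.2.2 + 1] := rfl
  simp [genTerm, h, Fin.prod_univ_three, pow_succ]
  ring

/-- Setting the middle variable to `0` kills every exponent except `s₂ = 1`, which survives because
`0 ^ 0 = 1`. The same device gives the next two series. -/
lemma hasSum_multiZeta_middle_one {x y : ℂ} (hx : ‖x‖ < 3) (hy : ‖y‖ < 1) :
    HasSum (fun p : ℕ × ℕ => x ^ p.1 * y ^ p.2 * (multiZeta ![p.1 + 2, 1, p.2 + 1] : ℂ))
      (sumThree x 0 y) := by
  have hi : Function.Injective fun p : ℕ × ℕ => (p.1, 0, p.2) := fun p q h => by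
    simpa [Prod.ext_iff] using h
  convert (hi.hasSum_iff ?_).2 (hasSum_sumThree hx (y := 0) (by simp) hy).2 using 1
  · funext p
    simp
  · rintro ⟨a, b, c⟩ h
    have hb : b ≠ 0 := by
      rintro rfl
      exact h ⟨(a, c), rfl⟩
    simp [hb]

lemma hasSum_multiZeta_last_one {x : ℂ} (hx : ‖x‖ < 2) :
    HasSum (fun p : ℕ => x ^ p * (multiZeta ![p + 2, 1] : ℂ)) (sumTwo x 0) := by
  have hi : Function.Injective fun p : ℕ => (p, 0) := fun p q h => by
    simpa [Prod.ext_iff] using h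
  convert (hi.hasSum_iff ?_).2 (hasSum_sumTwo hx (y := 0) (by simp)).2 using 1
  · funext p
    simp
  · rintro ⟨a, b⟩ h
    have hb : b ≠ 0 := by
      rintro rfl
      exact h ⟨a, rfl⟩
    simp [hb]

lemma hasSum_multiZeta_first_two {x : ℂ} (hx : ‖x‖ < 1) :
    HasSum (fun p : ℕ => x ^ p * (multiZeta ![2, p + 1] : ℂ)) (sumTwo 0 x) := by
  have hi : Function.Injective fun p : ℕ => (0, p) := fun p q h => by
    simpa [Prod.ext_iff] using h
  convert (hi.hasSum_iff ?_).2 (hasSum_sumTwo (x := 0) (by simp) hx).2 using 1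
  · funext p
    simp
  · rintro ⟨a, b⟩ h
    have hb : a ≠ 0 := by
      rintro rfl
      exact h ⟨b, rfl⟩
    simp [hb]

lemma hasSum_middleOneTerm {x y : ℂ} (hx : ‖x‖ < 3) (hy : ‖y‖ < 1) :
    HasSum (middleOneTerm x y) (x * sumThree x 0 y) := by
  let e : ℕ × ℕ ≃ {s : ℕ × ℕ // 2 ≤ s.1 ∧ 1 ≤ s.2} :=
    { toFun := fun p => ⟨(p.1 + 2, p.2 + 1), by simp⟩
      invFun := fun s => (s.1.1 - 2, s.1.2 - 1)
      left_inv := fun p => by simp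
      right_inv := fun s => by
        have := s.2
        ext <;> simp <;> omega }
  rw [← e.hasSum_iff]
  refine ((hasSum_multiZeta_middle_one hx hy).mul_left x).of_forall_eq fun p => ?_
  simp [middleOneTerm, e, pow_succ]
  ring

lemma hasSum_firstTwoTerm {x : ℂ} (hx : ‖x‖ < 1) :
    HasSum (firstTwoTerm x) (sumTwo 0 x) := by
  let e : ℕ ≃ {s : ℕ // 1 ≤ s} :=
    { toFun := fun p => ⟨p + 1, by simp⟩
      invFun := fun s => s.1 - 1
      left_inv := fun p => by simp
      right_inv := fun s => by
        have := s.2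
        ext; simp; omega }
  rw [← e.hasSum_iff]
  exact hasSum_multiZeta_first_two hx

lemma hasSum_lastOneTerm {x : ℂ} (hx : ‖x‖ < 2) :
    HasSum (lastOneTerm x) (x * sumTwo x 0) := by
  let e : ℕ ≃ {s : ℕ // 2 ≤ s} :=
    { toFun := fun p => ⟨p + 2, by simp⟩
      invFun := fun s => s.1 - 2
      left_inv := fun p => by simp
      right_inv := fun s => by
        have := s.2
        ext; simp; omega }
  rw [← e.hasSum_iff]
  refine ((hasSum_multiZeta_last_one hx).mul_left x).of_forall_eq fun p => ?_
  simp [lastOneTerm, e, pow_succ]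
  ring

/-! ### The shuffle and the stuffle expansion of a product -/

/-- The general term of
`∑_{m > 0} (1 / (m - x₃) - 1 / m) * ∑_{k₁ > k₂ > 0} (1 / (k₁ - x₁) - 1 / k₁) / (k₂ - x₂)`,
where the index consists of `m - 1` and the gaps of `k₁ > k₂ > 0`. -/
noncomputable def productTerm (x₁ x₂ x₃ : ℂ) (k : ℕ × ℕ × ℕ) : ℂ :=
  (((k.1 : ℂ) + 1 - x₃)⁻¹ - ((k.1 : ℂ) + 1)⁻¹) *
    (((k.2.1 : ℂ) + k.2.2 + 2 - x₁)⁻¹ - ((k.2.1 : ℂ) + k.2.2 + 2)⁻¹) * ((k.2.2 : ℂ) + 1 - x₂)⁻¹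

/-- The indices are free naturals tied to the gaps by equations, so that terms written in different
gap coordinates can share the same names; likewise for the kernels below. -/
lemma productTerm_eq {x₁ x₂ x₃ : ℂ} {a b c : ℕ} (m k₁ k₂ : ℕ) (hm : m = a + 1)
    (h₁ : k₁ = b + c + 2) (h₂ : k₂ = c + 1) :
    productTerm x₁ x₂ x₃ (a, b, c) = (((m : ℂ) - x₃)⁻¹ - (m : ℂ)⁻¹) *
      (((k₁ : ℂ) - x₁)⁻¹ - (k₁ : ℂ)⁻¹) * ((k₂ : ℂ) - x₂)⁻¹ := by
  subst hm h₁ h₂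
  simp [productTerm]

lemma kernelTwo_eq {x y : ℂ} {a b : ℕ} (k₁ k₂ : ℕ) (h₁ : k₁ = a + b + 2) (h₂ : k₂ = b + 1) :
    kernelTwo x y (a, b) = (k₁ : ℂ)⁻¹ * ((k₁ : ℂ) - x)⁻¹ * ((k₂ : ℂ) - y)⁻¹ := by
  subst h₁ h₂
  simp only [kernelTwo, one_div, mul_inv]
  push_cast
  rfl

lemma mul_inv_mul_inv_sub {x k : ℂ} (hk : k ≠ 0) (hx : k - x ≠ 0) :
    x * (k⁻¹ * (k - x)⁻¹) = (k - x)⁻¹ - k⁻¹ := by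
  field_simp
  ring

lemma mul_kernelTwo_eq {x y : ℂ} {a b : ℕ} (k₁ k₂ : ℕ) (hx : ‖x‖ < 2) (h₁ : k₁ = a + b + 2)
    (h₂ : k₂ = b + 1) :
    x * kernelTwo x y (a, b) = (((k₁ : ℂ) - x)⁻¹ - (k₁ : ℂ)⁻¹) * ((k₂ : ℂ) - y)⁻¹ := by
  have hk : (2 : ℝ) ≤ k₁ := by exact_mod_cast (show 2 ≤ k₁ by omega)
  rw [kernelTwo_eq k₁ k₂ h₁ h₂, ← mul_inv_mul_inv_sub (Nat.cast_ne_zero.2 (by omega))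
    (natCast_sub_ne_zero (hx.trans_le hk))]
  ring

lemma mul_kernelThree_eq {x y z : ℂ} {a b c : ℕ} (k₁ k₂ k₃ : ℕ) (hx : ‖x‖ < 3)
    (h₁ : k₁ = a + b + c + 3) (h₂ : k₂ = b + c + 2) (h₃ : k₃ = c + 1) :
    x * kernelThree x y z (a, b, c) =
      (((k₁ : ℂ) - x)⁻¹ - (k₁ : ℂ)⁻¹) * ((k₂ : ℂ) - y)⁻¹ * ((k₃ : ℂ) - z)⁻¹ := by
  have hk : (3 : ℝ) ≤ k₁ := by exact_mod_cast (show 3 ≤ k₁ by omega)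
  rw [← mul_inv_mul_inv_sub (Nat.cast_ne_zero.2 (by omega))
    (natCast_sub_ne_zero (hx.trans_le hk))]
  subst h₁ h₂ h₃
  simp only [kernelThree, one_div, mul_inv]
  push_cast
  ring

lemma inv_mul_inv_eq {p q : ℂ} (hp : p ≠ 0) (hq : q ≠ 0) (hpq : p + q ≠ 0) :
    p⁻¹ * q⁻¹ = (p + q)⁻¹ * (p⁻¹ + q⁻¹) := by
  field_simp
  ring

/-- Partial fractions are used twice: on the pair `m`, `k₁`, then, wherever the factor in `m` is the
one that survives, on the pair `m`, `k₂`. The resulting chains are `m + k₁ > k₁ > k₂`, `m + k₁ > m +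
k₂ > m` and `m + k₁ > m + k₂ > k₂`. -/
lemma hasSum_productTerm_shuffle {x₁ x₂ x₃ : ℂ} (h₁ : ‖x₁‖ < 2) (h₂ : ‖x₂‖ < 1)
    (h₃ : ‖x₃‖ < 1) :
    HasSum (productTerm x₁ x₂ x₃)
      ((x₁ + x₃) * sumThree (x₁ + x₃) x₁ x₂ - x₁ * sumThree x₁ x₁ x₂ - x₃ * sumThree x₃ 0 x₂
        + (x₁ + x₃) * sumThree (x₁ + x₃) (x₂ + x₃) x₃
        + (x₁ + x₃) * sumThree (x₁ + x₃) (x₂ + x₃) x₂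
        - x₃ * sumThree x₃ (x₂ + x₃) x₃ - x₃ * sumThree x₃ (x₂ + x₃) x₂
        - x₁ * sumThree x₁ x₂ 0 - x₁ * sumThree x₁ x₂ x₂) := by
  have h₁₃ : ‖x₁ + x₃‖ < 3 := (norm_add_le _ _).trans_lt (by linarith)
  have h₂₃ : ‖x₂ + x₃‖ < 2 := (norm_add_le _ _).trans_lt (by linarith)
  have h0 : ‖(0 : ℂ)‖ < 1 := by simp
  have g₁ : ‖x₁‖ < 3 := by linarith
  have g₂ : ‖x₂‖ < 2 := by linarith
  have g₃ : ‖x₃‖ < 3 := by linarith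
  have S : ∀ {x y z : ℂ}, ‖x‖ < 3 → ‖y‖ < 2 → ‖z‖ < 1 →
      HasSum (fun k => x * kernelThree x y z k) (x * sumThree x y z) :=
    fun hx hy hz => (hasSum_sumThree hx hy hz).1.mul_left _
  -- In gap coordinates, `e` gives the chain ending in `m` and `f` the chain `m + k₁ > m + k₂ > k₂`;
  -- the remaining chain needs no permutation.
  let e : ℕ × ℕ × ℕ ≃ ℕ × ℕ × ℕ := ⟨fun k => (k.2.1, k.2.2, k.1), fun k => (k.2.2, k.1, k.2.1),
    fun _ => rfl, fun _ => rfl⟩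
  let f : ℕ × ℕ × ℕ ≃ ℕ × ℕ × ℕ := ⟨fun k => (k.2.1, k.1, k.2.2), fun k => (k.2.1, k.1, k.2.2),
    fun _ => rfl, fun _ => rfl⟩
  refine ((((((((S h₁₃ h₁ h₂).sub (S g₁ h₁ h₂)).sub (S g₃ (by simp) h₂)).add
    (e.hasSum_iff.2 (S h₁₃ h₂₃ h₃))).add (f.hasSum_iff.2 (S h₁₃ h₂₃ h₂))).sub
    (e.hasSum_iff.2 (S g₃ h₂₃ h₃))).sub (f.hasSum_iff.2 (S g₃ h₂₃ h₂))).sub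
    (e.hasSum_iff.2 (S g₁ g₂ h0))).sub (f.hasSum_iff.2 (S g₁ g₂ h₂)) |>.of_forall_eq ?_
  rintro ⟨a, b, c⟩
  obtain ⟨m, hm⟩ : ∃ m, m = a + 1 := ⟨_, rfl⟩
  obtain ⟨k, hk⟩ : ∃ k, k = b + c + 2 := ⟨_, rfl⟩
  obtain ⟨l, hl⟩ : ∃ l, l = c + 1 := ⟨_, rfl⟩
  rw [productTerm_eq m k l hm hk hl]
  simp only [Function.comp_apply, e, f, Equiv.coe_fn_mk]
  rw [mul_kernelThree_eq (m + k) k l h₁₃ (by omega) (by omega) (by omega),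
    mul_kernelThree_eq (m + k) k l g₁ (by omega) (by omega) (by omega),
    mul_kernelThree_eq (m + k) k l g₃ (by omega) (by omega) (by omega),
    mul_kernelThree_eq (m + k) (m + l) m h₁₃ (by omega) (by omega) (by omega),
    mul_kernelThree_eq (m + k) (m + l) l h₁₃ (by omega) (by omega) (by omega),
    mul_kernelThree_eq (m + k) (m + l) m g₃ (by omega) (by omega) (by omega),
    mul_kernelThree_eq (m + k) (m + l) l g₃ (by omega) (by omega) (by omega),
    mul_kernelThree_eq (m + k) (m + l) m g₁ (by omega) (by omega) (by omega),
    mul_kernelThree_eq (m + k) (m + l) l g₁ (by omega) (by omega) (by omega)]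
  have hm1 : (1 : ℝ) ≤ m := by exact_mod_cast (show 1 ≤ m by omega)
  have hk2 : (2 : ℝ) ≤ k := by exact_mod_cast (show 2 ≤ k by omega)
  have hl1 : (1 : ℝ) ≤ l := by exact_mod_cast (show 1 ≤ l by omega)
  have m0 : (m : ℂ) ≠ 0 := Nat.cast_ne_zero.2 (by omega)
  have k0 : (k : ℂ) ≠ 0 := Nat.cast_ne_zero.2 (by omega)
  have mx : (m : ℂ) - x₃ ≠ 0 := natCast_sub_ne_zero (by linarith)
  have kx : (k : ℂ) - x₁ ≠ 0 := natCast_sub_ne_zero (by linarith)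
  have lx : (l : ℂ) - x₂ ≠ 0 := natCast_sub_ne_zero (by linarith)
  have mk : ∀ {x : ℂ}, ‖x‖ < 3 → (m : ℂ) + k - x ≠ 0 := fun {x} hx => by
    have := natCast_sub_ne_zero (x := x) (n := m + k) (by push_cast; linarith)
    rwa [Nat.cast_add] at this
  have ml : ∀ {x : ℂ}, ‖x‖ < 2 → (m : ℂ) + l - x ≠ 0 := fun {x} hx => by
    have := natCast_sub_ne_zero (x := x) (n := m + l) (by push_cast; linarith)
    rwa [Nat.cast_add] at this
  have c1 : (m : ℂ) - x₃ + (k - x₁) = m + k - (x₁ + x₃) := by ring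
  have c2 : (m : ℂ) - x₃ + k = m + k - x₃ := by ring
  have c3 : (m : ℂ) + (k - x₁) = m + k - x₁ := by ring
  have c5 : (m : ℂ) - x₃ + (l - x₂) = m + l - (x₂ + x₃) := by ring
  have c6 : (m : ℂ) + (l - x₂) = m + l - x₂ := by ring
  have e1 := inv_mul_inv_eq mx kx (c1 ▸ mk h₁₃)
  have e2 := inv_mul_inv_eq mx k0 (c2 ▸ mk g₃)
  have e3 := inv_mul_inv_eq m0 kx (c3 ▸ mk g₁)
  have e4 := inv_mul_inv_eq m0 k0 (by simpa using mk (x := 0) (by simp))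
  have e5 := inv_mul_inv_eq mx lx (c5 ▸ ml h₂₃)
  have e6 := inv_mul_inv_eq m0 lx (c6 ▸ ml g₂)
  rw [c1] at e1
  rw [c2] at e2
  rw [c3] at e3
  rw [c5] at e5
  rw [c6] at e6
  push_cast
  rw [sub_zero, sub_zero]
  generalize ((m : ℂ) - x₃)⁻¹ = I2 at *
  generalize ((m : ℂ))⁻¹ = I1 at *
  generalize ((k : ℂ) - x₁)⁻¹ = J2 at *
  generalize ((k : ℂ))⁻¹ = J1 at *
  generalize ((l : ℂ) - x₂)⁻¹ = L at *
  generalize ((m : ℂ) + k - (x₁ + x₃))⁻¹ = M13 at *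
  generalize ((m : ℂ) + k - x₁)⁻¹ = M1 at *
  generalize ((m : ℂ) + k - x₃)⁻¹ = M3 at *
  generalize ((m : ℂ) + k)⁻¹ = M0 at *
  generalize ((m : ℂ) + l - (x₂ + x₃))⁻¹ = N23 at *
  generalize ((m : ℂ) + l - x₂)⁻¹ = N2 at *
  -- `e1` to `e4` split the four products in `m` and `k`; the coefficients left on `I2 * L` and `I1
  -- * L` are `M13 - M3` and `M0 - M1`.
  linear_combination L * (e1 - e2 - e3 + e4) + (M13 - M3) * e5 + (M0 - M1) * e6

/-- The relative positions of `m` and `k₁ > k₂ > 0`: `m > k₁`, `k₁ > m > k₂`, `k₂ > m`, `m = k₁`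
and `m = k₂`, in gap coordinates. -/
def stuffleMap : (ℕ × ℕ × ℕ) ⊕ (ℕ × ℕ × ℕ) ⊕ (ℕ × ℕ × ℕ) ⊕ (ℕ × ℕ) ⊕ (ℕ × ℕ) → ℕ × ℕ × ℕ
  | .inl (i, a, b) => (a + b + 2 + i, a, b)
  | .inr (.inl (i, j, b)) => (b + 1 + j, i + j + 1, b)
  | .inr (.inr (.inl (i, j, m))) => (m, i, m + 1 + j)
  | .inr (.inr (.inr (.inl (a, b)))) => (a + b + 1, a, b)
  | .inr (.inr (.inr (.inr (a, b)))) => (b, a, b)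

lemma stuffleMap_bijective : Function.Bijective stuffleMap := by
  constructor
  · rintro (⟨i, a, b⟩ | ⟨i, a, b⟩ | ⟨i, a, b⟩ | ⟨a, b⟩ | ⟨a, b⟩)
      (⟨i', a', b'⟩ | ⟨i', a', b'⟩ | ⟨i', a', b'⟩ | ⟨a', b'⟩ | ⟨a', b'⟩) h <;>
    simp only [stuffleMap, Prod.mk.injEq] at h <;>
    simp only [Sum.inl.injEq, Sum.inr.injEq, Prod.mk.injEq, reduceCtorEq] <;> omega
  · rintro ⟨m, a, b⟩
    rcases lt_trichotomy m b with h | rfl | h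
    · exact ⟨.inr (.inr (.inl (a, b - m - 1, m))), by simp [stuffleMap]; omega⟩
    · exact ⟨.inr (.inr (.inr (.inr (a, m)))), rfl⟩
    rcases lt_trichotomy m (a + b + 1) with h' | rfl | h'
    · exact ⟨.inr (.inl (a + b - m, m - b - 1, b)), by simp [stuffleMap]; omega⟩
    · exact ⟨.inr (.inr (.inr (.inl (a, b)))), rfl⟩
    · exact ⟨.inl (m - a - b - 2, a, b), by simp [stuffleMap]; omega⟩

lemma inv_sub_mul_inv_sub {k x y : ℂ} (hx : k - x ≠ 0) (hy : k - y ≠ 0) (h : y - x ≠ 0) :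
    (k - y)⁻¹ * (k - x)⁻¹ = ((k - y)⁻¹ - (k - x)⁻¹) / (y - x) := by
  rw [eq_div_iff h]
  field_simp
  ring

/-- The factor `x₂` serves the diagonal `m = k₂`, where `x₂ / (k₂ (k₂ - x₂)) = 1/(k₂ - x₂) - 1/k₂`
avoids a division by `x₂`. The diagonals are also where `x₃ ≠ x₁` and `x₃ ≠ x₂` enter, again through
partial fractions. -/
lemma hasSum_productTerm_stuffle {x₁ x₂ x₃ : ℂ} (h₁ : ‖x₁‖ < 2) (h₂ : ‖x₂‖ < 1)
    (h₃ : ‖x₃‖ < 1) (h₃₁ : x₃ ≠ x₁) (h₃₂ : x₃ ≠ x₂) :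
    HasSum (fun k => x₂ * productTerm x₁ x₂ x₃ k)
      (x₂ * (x₃ * sumThree x₃ x₁ x₂ - x₃ * sumThree x₃ 0 x₂)
        + (x₂ * (x₁ * sumThree x₁ x₃ x₂ - x₁ * sumThree x₁ 0 x₂)
        + (x₂ * (x₁ * sumThree x₁ x₂ x₃ - x₁ * sumThree x₁ x₂ 0)
        + (x₂ * ((x₃ - x₁)⁻¹ * (x₃ * sumTwo x₃ x₂ - x₁ * sumTwo x₁ x₂)
            - sumTwo x₃ x₂ - sumTwo x₁ x₂ + sumTwo 0 x₂)
        + (x₂ * (x₃ - x₂)⁻¹ * (x₁ * sumTwo x₁ x₃ - x₁ * sumTwo x₁ x₂)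
            - x₁ * sumTwo x₁ x₂ + x₁ * sumTwo x₁ 0))))) := by
  have h0 : ‖(0 : ℂ)‖ < 1 := by simp
  have h0' : ‖(0 : ℂ)‖ < 2 := by simp
  have g₁ : ‖x₁‖ < 3 := by linarith
  have g₂ : ‖x₂‖ < 2 := by linarith
  have g₃ : ‖x₃‖ < 3 := by linarith
  have g₃' : ‖x₃‖ < 2 := by linarith
  have S : ∀ {x y z : ℂ}, ‖x‖ < 3 → ‖y‖ < 2 → ‖z‖ < 1 →
      HasSum (fun k => x * kernelThree x y z k) (x * sumThree x y z) :=
    fun hx hy hz => (hasSum_sumThree hx hy hz).1.mul_left _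
  have T : ∀ {x y : ℂ}, ‖x‖ < 2 → ‖y‖ < 1 → HasSum (kernelTwo x y) (sumTwo x y) :=
    fun hx hy => (hasSum_sumTwo hx hy).1
  have T' : ∀ {x y : ℂ}, ‖x‖ < 2 → ‖y‖ < 1 →
      HasSum (fun k => x * kernelTwo x y k) (x * sumTwo x y) := fun hx hy => (T hx hy).mul_left _
  rw [← (Equiv.ofBijective _ stuffleMap_bijective).hasSum_iff]
  refine HasSum.sum ?_ (HasSum.sum ?_ (HasSum.sum ?_ (HasSum.sum ?_ ?_)))
  · refine (((S g₃ h₁ h₂).sub (S g₃ h0' h₂)).mul_left x₂).of_forall_eq ?_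
    rintro ⟨i, a, b⟩
    simp only [Function.comp_apply, Equiv.ofBijective_apply, stuffleMap]
    rw [productTerm_eq (a + b + i + 3) (a + b + 2) (b + 1) (by omega) (by omega) (by omega),
      mul_kernelThree_eq (a + b + i + 3) (a + b + 2) (b + 1) g₃ (by omega) (by omega) (by omega),
      mul_kernelThree_eq (a + b + i + 3) (a + b + 2) (b + 1) g₃ (by omega) (by omega) (by omega),
      sub_zero]
    ring
  · refine (((S g₁ g₃' h₂).sub (S g₁ h0' h₂)).mul_left x₂).of_forall_eq ?_
    rintro ⟨i, a, b⟩
    simp only [Function.comp_apply, Equiv.ofBijective_apply, stuffleMap]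
    rw [productTerm_eq (a + b + 2) (a + b + i + 3) (b + 1) (by omega) (by omega) (by omega),
      mul_kernelThree_eq (a + b + i + 3) (a + b + 2) (b + 1) g₁ (by omega) (by omega) (by omega),
      mul_kernelThree_eq (a + b + i + 3) (a + b + 2) (b + 1) g₁ (by omega) (by omega) (by omega),
      sub_zero]
    ring
  · refine (((S g₁ g₂ h₃).sub (S g₁ g₂ h0)).mul_left x₂).of_forall_eq ?_
    rintro ⟨i, a, b⟩
    simp only [Function.comp_apply, Equiv.ofBijective_apply, stuffleMap]
    rw [productTerm_eq (b + 1) (a + b + i + 3) (a + b + 2) (by omega) (by omega) (by omega),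
      mul_kernelThree_eq (a + b + i + 3) (a + b + 2) (b + 1) g₁ (by omega) (by omega) (by omega),
      mul_kernelThree_eq (a + b + i + 3) (a + b + 2) (b + 1) g₁ (by omega) (by omega) (by omega),
      sub_zero]
    ring
  · refine (((((((T' g₃' h₂).sub (T' h₁ h₂)).mul_left (x₃ - x₁)⁻¹).sub (T g₃' h₂)).sub
      (T h₁ h₂)).add (T h0' h₂)).mul_left x₂).of_forall_eq ?_
    rintro ⟨a, b⟩
    obtain ⟨k, hk⟩ : ∃ k, k = a + b + 2 := ⟨_, rfl⟩
    have hk2 : (2 : ℝ) ≤ k := by exact_mod_cast (show 2 ≤ k by omega)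
    simp only [Function.comp_apply, Equiv.ofBijective_apply, stuffleMap]
    rw [productTerm_eq k k (b + 1) (by omega) (by omega) (by omega),
      mul_kernelTwo_eq k (b + 1) g₃' hk rfl, mul_kernelTwo_eq k (b + 1) h₁ hk rfl,
      kernelTwo_eq k (b + 1) hk rfl, kernelTwo_eq k (b + 1) hk rfl,
      kernelTwo_eq k (b + 1) hk rfl, sub_zero]
    have e := inv_sub_mul_inv_sub (natCast_sub_ne_zero (h₁.trans_le hk2))
      (natCast_sub_ne_zero (g₃'.trans_le hk2)) (sub_ne_zero.2 h₃₁)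
    rw [div_eq_mul_inv] at e
    linear_combination x₂ * (((b + 1 : ℕ) : ℂ) - x₂)⁻¹ * e
  · refine ((((T' h₁ h₃).sub (T' h₁ h₂)).mul_left (x₂ * (x₃ - x₂)⁻¹)).sub (T' h₁ h₂)).add
      (T' h₁ h0) |>.of_forall_eq ?_
    rintro ⟨a, b⟩
    obtain ⟨l, hl⟩ : ∃ l, l = b + 1 := ⟨_, rfl⟩
    have hl1 : (1 : ℝ) ≤ l := by exact_mod_cast (show 1 ≤ l by omega)
    simp only [Function.comp_apply, Equiv.ofBijective_apply, stuffleMap]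
    rw [productTerm_eq l (a + b + 2) l (by omega) (by omega) (by omega),
      mul_kernelTwo_eq (a + b + 2) l h₁ rfl hl, mul_kernelTwo_eq (a + b + 2) l h₁ rfl hl,
      mul_kernelTwo_eq (a + b + 2) l h₁ rfl hl, sub_zero]
    have lx := natCast_sub_ne_zero (h₂.trans_le hl1)
    have e := inv_sub_mul_inv_sub lx (natCast_sub_ne_zero (h₃.trans_le hl1)) (sub_ne_zero.2 h₃₂)
    have e' := mul_inv_mul_inv_sub (Nat.cast_ne_zero.2 (by omega)) lx
    rw [div_eq_mul_inv] at e
    linear_combination ((((a + b + 2 : ℕ) : ℂ) - x₁)⁻¹ - ((a + b + 2 : ℕ) : ℂ)⁻¹) * (x₂ * e - e')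

/-- The double shuffle relation between the generating functions, free of the denominators
`x₁`, `x₂`, `x₃`. -/
lemma sumThree_double_shuffle {x₁ x₂ x₃ : ℂ} (h₁ : ‖x₁‖ < 2) (h₂ : ‖x₂‖ < 1)
    (h₃ : ‖x₃‖ < 1) (h₃₁ : x₃ ≠ x₁) (h₃₂ : x₃ ≠ x₂) :
    x₂ * ((x₁ + x₃) * sumThree (x₁ + x₃) x₁ x₂ - x₁ * sumThree x₁ x₁ x₂
        + (x₁ + x₃) * sumThree (x₁ + x₃) (x₂ + x₃) x₂ - x₃ * sumThree x₃ (x₂ + x₃) x₂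
        - x₁ * sumThree x₁ x₂ x₂
        + (x₁ + x₃) * sumThree (x₁ + x₃) (x₂ + x₃) x₃ - x₃ * sumThree x₃ (x₂ + x₃) x₃
        - x₁ * sumThree x₁ x₂ x₃ - x₁ * sumThree x₁ x₃ x₂ - x₃ * sumThree x₃ x₁ x₂)
      = x₂ * (x₃ - x₁)⁻¹ * (x₃ * sumTwo x₃ x₂ - x₁ * sumTwo x₁ x₂)
        + x₂ * (x₃ - x₂)⁻¹ * (x₁ * sumTwo x₁ x₃ - x₁ * sumTwo x₁ x₂)
        - x₂ * sumTwo x₁ x₂ - x₂ * sumTwo x₃ x₂ - x₁ * sumTwo x₁ x₂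
        - x₂ * x₁ * sumThree x₁ 0 x₂ + x₂ * sumTwo 0 x₂ + x₁ * sumTwo x₁ 0 := by
  have h := ((hasSum_productTerm_shuffle h₁ h₂ h₃).mul_left x₂).unique
    (hasSum_productTerm_stuffle h₁ h₂ h₃ h₃₁ h₃₂)
  linear_combination h

/-! ### Comparison of coefficients -/

/-- Extend by zero off the range of `e` and group by the value of `w`; the finite sets `s n` are the
fibres within that range. -/
lemma HasSum.sum_fibers {ι κ : Type*} {e : ι → κ} (he : Function.Injective e) (w : κ → ℕ)
    {s : ℕ → Finset κ} (hs : ∀ n k, k ∈ s n ↔ k ∈ Set.range e ∧ w k = n) {f : κ → ℂ} {a : ℂ}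
    (h : HasSum (fun i => f (e i)) a) : HasSum (fun n => ∑ k ∈ s n, f k) a := by
  have h1 : HasSum ((Set.range e).indicator f) a := by
    rw [← he.hasSum_iff fun k hk => Set.indicator_of_notMem hk f]
    exact h.of_forall_eq fun i => Set.indicator_of_mem (Set.mem_range_self i) f
  refine (h1.tsum_fiberwise w).of_forall_eq fun n => ?_
  rw [tsum_subtype (w ⁻¹' {n}) ((Set.range e).indicator f), Set.indicator_indicator,
    tsum_eq_sum (s := s n)]
  · refine Finset.sum_congr rfl fun k hk => ?_
    obtain ⟨h2, h3⟩ := (hs n k).1 hk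
    exact (Set.indicator_of_mem (show k ∈ w ⁻¹' {n} ∩ Set.range e from ⟨h3, h2⟩) f).symm
  · intro k hk
    refine Set.indicator_of_notMem (fun h2 => hk ((hs n k).2 ⟨h2.2, h2.1⟩)) f

lemma hasSum_weightTriples {t X : ℂ} {φ : ℕ × ℕ × ℕ → ℂ}
    (h : HasSum (fun p : ℕ × ℕ × ℕ => t ^ (p.1 + p.2.1 + p.2.2 + 4) *
      φ (p.1 + 2, p.2.1 + 1, p.2.2 + 1)) X) :
    HasSum (fun n => t ^ (n + 3) * ∑ p ∈ weightTriples (n + 3), φ p) X := by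
  have he : Function.Injective fun p : ℕ × ℕ × ℕ => (p.1 + 2, p.2.1 + 1, p.2.2 + 1) :=
    fun p q h => by simpa [Prod.ext_iff] using h
  have hs : ∀ n (k : ℕ × ℕ × ℕ), k ∈ weightTriples (n + 3) ↔
      k ∈ Set.range (fun p : ℕ × ℕ × ℕ => (p.1 + 2, p.2.1 + 1, p.2.2 + 1)) ∧
        k.1 + k.2.1 + k.2.2 - 3 = n := by
    rintro n ⟨i, j, l⟩
    simp only [weightTriples, Finset.mem_filter, Finset.mem_product, Finset.mem_Icc,
      Set.mem_range, Prod.mk.injEq, Prod.exists]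
    constructor
    · intro h
      exact ⟨⟨i - 2, j - 1, l - 1, by omega⟩, by omega⟩
    · rintro ⟨⟨a, b, c, h⟩, h'⟩
      omega
  refine (HasSum.sum_fibers he (fun k => k.1 + k.2.1 + k.2.2 - 3) hs
    (f := fun p => t ^ (p.1 + p.2.1 + p.2.2) * φ p) (h.of_forall_eq fun p => ?_)).of_forall_eq
      fun n => ?_
  · congr 2
    dsimp only
    omega
  · rw [Finset.mul_sum]
    refine Finset.sum_congr rfl fun p hp => ?_
    rw [(Finset.mem_filter.1 hp).2]

lemma hasSum_weightPairs {t X : ℂ} {φ : ℕ × ℕ → ℂ}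
    (h : HasSum (fun p : ℕ × ℕ => t ^ (p.1 + p.2 + 3) * φ (p.1 + 2, p.2 + 1)) X) :
    HasSum (fun n => t ^ (n + 3) * ∑ p ∈ weightPairs (n + 3), φ p) X := by
  have he : Function.Injective fun p : ℕ × ℕ => (p.1 + 2, p.2 + 1) :=
    fun p q h => by simpa [Prod.ext_iff] using h
  have hs : ∀ n (k : ℕ × ℕ), k ∈ weightPairs (n + 3) ↔
      k ∈ Set.range (fun p : ℕ × ℕ => (p.1 + 2, p.2 + 1)) ∧ k.1 + k.2 - 3 = n := by
    rintro n ⟨i, j⟩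
    simp only [weightPairs, Finset.mem_filter, Finset.mem_product, Finset.mem_Icc,
      Set.mem_range, Prod.mk.injEq, Prod.exists]
    constructor
    · intro h
      exact ⟨⟨i - 2, j - 1, by omega⟩, by omega⟩
    · rintro ⟨⟨a, b, h⟩, h'⟩
      omega
  refine (HasSum.sum_fibers he (fun k => k.1 + k.2 - 3) hs
    (f := fun p => t ^ (p.1 + p.2) * φ p) (h.of_forall_eq fun p => ?_)).of_forall_eq
      fun n => ?_
  · congr 2
    dsimp only
    omega
  · rw [Finset.mul_sum]
    refine Finset.sum_congr rfl fun p hp => ?_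
    rw [(Finset.mem_filter.1 hp).2]

lemma hasSum_Icc_weight {t X : ℂ} {φ : ℕ → ℕ → ℂ}
    (h : HasSum (fun p : ℕ × ℕ => t ^ (p.1 + p.2 + 4) * φ (p.1 + 2) (p.2 + 1)) X) :
    HasSum (fun n => t ^ (n + 3) * ∑ k ∈ Finset.Icc 2 (n + 1), φ k (n + 2 - k)) X := by
  -- The second coordinate records the weight `k + 1 + l` of `ζ(k, 1, l)`, from which `l` is
  -- recovered.
  have he : Function.Injective fun p : ℕ × ℕ => (p.1 + 2, p.1 + p.2 + 4) := fun p q h => by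
    simp only [Prod.mk.injEq] at h
    ext <;> omega
  have hs : ∀ n (k : ℕ × ℕ), k ∈ Finset.Icc 2 (n + 1) ×ˢ {n + 3} ↔
      k ∈ Set.range (fun p : ℕ × ℕ => (p.1 + 2, p.1 + p.2 + 4)) ∧ k.2 - 3 = n := by
    rintro n ⟨i, j⟩
    simp only [Finset.mem_product, Finset.mem_Icc, Finset.mem_singleton,
      Set.mem_range, Prod.mk.injEq, Prod.exists]
    constructor
    · intro h
      exact ⟨⟨i - 2, j - i - 2, by omega⟩, by omega⟩
    · rintro ⟨⟨a, b, h⟩, h'⟩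
      omega
  refine (HasSum.sum_fibers he (fun k => k.2 - 3) hs
    (f := fun p => t ^ p.2 * φ p.1 (p.2 - 1 - p.1)) (h.of_forall_eq fun p => ?_)).of_forall_eq
      fun n => ?_
  · congr 2
    dsimp only
    omega
  · rw [Finset.mul_sum, Finset.sum_product]
    simp

/-- Uniqueness of power series coefficients, after padding with three zeros. The point `t = 0` may
be excluded because every term vanishes there; this matters since `tc ≠ ta` requires `t ≠ 0`. -/
lemma eq_zero_of_hasSum_zero {D : ℕ → ℂ}
    (h : ∀ᶠ t : ℂ in nhds 0, t ≠ 0 → HasSum (fun n => t ^ (n + 3) * D n) 0) (n : ℕ) :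
    D n = 0 := by
  let C : ℕ → ℂ := fun n => if n < 3 then 0 else D (n - 3)
  have hC : HasFPowerSeriesAt 0 (FormalMultilinearSeries.ofScalars ℂ C) (0 : ℂ) := by
    rw [hasFPowerSeriesAt_iff]
    filter_upwards [h] with t ht
    have h0 : HasSum (fun n => t ^ (n + 3) * D n) 0 := by
      rcases eq_or_ne t 0 with rfl | h0
      · simp
      · exact ht h0
    simp only [FormalMultilinearSeries.coeff_ofScalars, smul_eq_mul, Pi.zero_apply]
    rw [← (add_left_injective 3).hasSum_iff]
    · exact h0.of_forall_eq fun n => by simp [C]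
    · intro n hn
      have : n < 3 := by
        by_contra hlt
        exact hn ⟨n - 3, by dsimp only; omega⟩
      simp [C, this]
  have hz : (FormalMultilinearSeries.ofScalars ℂ C).coeff (n + 3) = 0 := by
    rw [hC.eq_zero]
    rfl
  rw [FormalMultilinearSeries.coeff_ofScalars] at hz
  simpa only [C, show ¬ n + 3 < 3 by omega, if_false, Nat.add_sub_cancel] using hz

/-! ### The weighted sum formula -/

/-- The coefficient of `ζ(j, k, l)` in the weighted sum formula. -/
def tripleCoeff {R : Type*} [CommRing R] (a b c : R) (j k l : ℕ) : R :=
  (a + c) ^ (j - 1) * a ^ k * b ^ l * c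
    + a * (a + c) ^ (j - 1) * (b + c) ^ (k - 1) * (c * b ^ l + b * c ^ l)
    - a ^ (j + k - 1) * b ^ l * c
    - a ^ j * b ^ (k + l - 1) * c
    - a * c ^ j * (b + c) ^ (k - 1) * (b ^ l + b * c ^ (l - 1))
    - a ^ j * b ^ k * c ^ l - a ^ j * c ^ k * b ^ l - c ^ j * a ^ k * b ^ l

/-- The coefficient of `ζ(j, k)` in the weighted sum formula. -/
def pairCoeff {R : Type*} [Field R] (a b c : R) (j k : ℕ) : R :=
  (a * c ^ j - a ^ j * c) * b ^ k / (c - a)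
    + a ^ j * (b * c ^ k - b ^ k * c) / (c - b)
    - a ^ (j - 1) * b ^ k * c - a * b ^ k * c ^ (j - 1) - a ^ j * b ^ (k - 1) * c

/-- The right side of the weighted sum formula of weight `n + 3`. -/
noncomputable def weightedRight (a b c : ℂ) (n : ℕ) : ℂ :=
  (∑ p ∈ weightPairs (n + 3), pairCoeff a b c p.1 p.2 * (multiZeta ![p.1, p.2] : ℂ))
    - (∑ k ∈ Finset.Icc 2 (n + 1),
        a ^ k * b ^ (n + 2 - k) * c * (multiZeta ![k, 1, n + 2 - k] : ℂ))
    + a * b ^ (n + 1) * c * (multiZeta ![2, n + 1] : ℂ)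
    + a ^ (n + 2) * c * (multiZeta ![n + 2, 1] : ℂ)

lemma hasSum_weightedLeft {a b c t : ℂ} (h₁ : ‖t * a‖ < 2) (h₂ : ‖t * b‖ < 1)
    (h₃ : ‖t * c‖ < 1) :
    HasSum (fun n => t ^ (n + 3) * ∑ p ∈ weightTriples (n + 3),
        tripleCoeff a b c p.1 p.2.1 p.2.2 * (multiZeta ![p.1, p.2.1, p.2.2] : ℂ))
      (t * a * (t * c) * (t * b * ((t * a + t * c) * sumThree (t * a + t * c) (t * a) (t * b)
        - t * a * sumThree (t * a) (t * a) (t * b)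
        + (t * a + t * c) * sumThree (t * a + t * c) (t * b + t * c) (t * b)
        - t * c * sumThree (t * c) (t * b + t * c) (t * b)
        - t * a * sumThree (t * a) (t * b) (t * b)
        + (t * a + t * c) * sumThree (t * a + t * c) (t * b + t * c) (t * c)
        - t * c * sumThree (t * c) (t * b + t * c) (t * c)
        - t * a * sumThree (t * a) (t * b) (t * c)
        - t * a * sumThree (t * a) (t * c) (t * b)
        - t * c * sumThree (t * c) (t * a) (t * b)))) := by
  have h₁₃ : ‖t * a + t * c‖ < 3 := (norm_add_le _ _).trans_lt (by linarith)
  have h₂₃ : ‖t * b + t * c‖ < 2 := (norm_add_le _ _).trans_lt (by linarith)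
  have g₁ : ‖t * a‖ < 3 := by linarith
  have g₂ : ‖t * b‖ < 2 := by linarith
  have g₃ : ‖t * c‖ < 3 := by linarith
  have g₃' : ‖t * c‖ < 2 := by linarith
  have S : ∀ {x y z : ℂ}, ‖x‖ < 3 → ‖y‖ < 2 → ‖z‖ < 1 →
      HasSum (fun p : ℕ × ℕ × ℕ => x * (x ^ p.1 * y ^ p.2.1 * z ^ p.2.2 *
        (multiZeta ![p.1 + 2, p.2.1 + 1, p.2.2 + 1] : ℂ))) (x * sumThree x y z) :=
    fun hx hy hz => (hasSum_sumThree hx hy hz).2.mul_left _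
  refine hasSum_weightTriples (φ := fun p : ℕ × ℕ × ℕ =>
    tripleCoeff a b c p.1 p.2.1 p.2.2 * (multiZeta ![p.1, p.2.1, p.2.2] : ℂ)) ?_
  refine (((((((((((S h₁₃ h₁ h₂).sub (S g₁ h₁ h₂)).add (S h₁₃ h₂₃ h₂)).sub (S g₃ h₂₃ h₂)).sub
    (S g₁ g₂ h₂)).add (S h₁₃ h₂₃ h₃)).sub (S g₃ h₂₃ h₃)).sub (S g₁ g₂ h₃)).sub
    (S g₁ g₃' h₂)).sub (S g₃ h₁ h₂)).mul_left (t * b)).mul_left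
    (t * a * (t * c)) |>.of_forall_eq ?_
  rintro ⟨i, j, k⟩
  simp only [tripleCoeff, show i + 2 - 1 = i + 1 by omega, show j + 1 - 1 = j by omega,
    show k + 1 - 1 = k by omega, show i + 2 + (j + 1) - 1 = i + j + 2 by omega,
    show j + 1 + (k + 1) - 1 = j + k + 1 by omega, ← mul_add, mul_pow]
  ring

lemma hasSum_weightedRight {a b c t : ℂ} (h₁ : ‖t * a‖ < 2) (h₂ : ‖t * b‖ < 1)
    (h₃ : ‖t * c‖ < 1) :
    HasSum (fun n => t ^ (n + 3) * weightedRight a b c n)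
      (t * a * (t * c) * (t * b * (t * c - t * a)⁻¹ *
            (t * c * sumTwo (t * c) (t * b) - t * a * sumTwo (t * a) (t * b))
          + t * b * (t * c - t * b)⁻¹ *
            (t * a * sumTwo (t * a) (t * c) - t * a * sumTwo (t * a) (t * b))
          - t * b * sumTwo (t * a) (t * b) - t * b * sumTwo (t * c) (t * b)
          - t * a * sumTwo (t * a) (t * b))
        - t * a * (t * c) * (t * b * (t * a)) * sumThree (t * a) 0 (t * b)
        + t * a * (t * c) * (t * b) * sumTwo 0 (t * b)
        + t * a * (t * c) * (t * a) * sumTwo (t * a) 0) := by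
  have g₃' : ‖t * c‖ < 2 := by linarith
  have T : ∀ {x y : ℂ} (u : ℂ), ‖x‖ < 2 → ‖y‖ < 1 →
      HasSum (fun p : ℕ × ℕ => u * (x ^ p.1 * y ^ p.2 *
        (multiZeta ![p.1 + 2, p.2 + 1] : ℂ))) (u * sumTwo x y) :=
    fun u hx hy => (hasSum_sumTwo hx hy).2.mul_left u
  have p1 := hasSum_weightPairs (t := t) (φ := fun p : ℕ × ℕ =>
    pairCoeff a b c p.1 p.2 * (multiZeta ![p.1, p.2] : ℂ))
    ((((((((T (t * c) g₃' h₂).sub (T (t * a) h₁ h₂)).mul_left (t * b * (t * c - t * a)⁻¹)).add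
      (((T (t * a) h₁ h₃).sub (T (t * a) h₁ h₂)).mul_left (t * b * (t * c - t * b)⁻¹))).sub
      (T (t * b) h₁ h₂)).sub (T (t * b) g₃' h₂)).sub (T (t * a) h₁ h₂)).mul_left
      (t * a * (t * c)) |>.of_forall_eq (by
        rintro ⟨i, j⟩
        simp only [pairCoeff, show i + 2 - 1 = i + 1 by omega, show j + 1 - 1 = j by omega,
          ← mul_sub, mul_pow, mul_inv, div_eq_mul_inv]
        -- What remains inverted is `t`, and it is multiplied by enough factors `t` that the
        -- identity also holds at `t = 0`.
        generalize (c - a)⁻¹ = u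
        generalize (c - b)⁻¹ = v
        field_simp
        ring))
  have p2 := hasSum_Icc_weight (t := t) (φ := fun k l =>
    a ^ k * b ^ l * c * (multiZeta ![k, 1, l] : ℂ))
    (((hasSum_multiZeta_middle_one (h₁.trans (by norm_num)) h₂).mul_left
      (t * a * (t * c) * (t * b * (t * a)))).of_forall_eq (by
        rintro ⟨i, j⟩
        simp only [mul_pow]
        ring))
  have p3 := (hasSum_multiZeta_first_two h₂).mul_left (t * a * (t * c) * (t * b))
  have p4 := (hasSum_multiZeta_last_one h₁).mul_left (t * a * (t * c) * (t * a))
  refine (((p1.sub p2).add p3).add p4).of_forall_eq fun n => ?_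
  simp only [weightedRight, mul_pow]
  ring

lemma weighted_sum_formula {a b c : ℂ} (hca : c ≠ a) (hcb : c ≠ b) (n : ℕ) :
    ∑ p ∈ weightTriples (n + 3),
        tripleCoeff a b c p.1 p.2.1 p.2.2 * (multiZeta ![p.1, p.2.1, p.2.2] : ℂ) =
      weightedRight a b c n := by
  have hsmall : ∀ x : ℂ, ∀ᶠ t : ℂ in nhds 0, ‖t * x‖ < 1 := fun x => by
    have hc : Continuous fun t : ℂ => ‖t * x‖ := by fun_prop
    exact hc.continuousAt.eventually_lt_const (by simp)
  refine sub_eq_zero.1 (eq_zero_of_hasSum_zero (D := fun n => ∑ p ∈ weightTriples (n + 3),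
    tripleCoeff a b c p.1 p.2.1 p.2.2 * (multiZeta ![p.1, p.2.1, p.2.2] : ℂ) -
      weightedRight a b c n) ?_ n)
  filter_upwards [hsmall a, hsmall b, hsmall c] with t ha hb hc ht
  have ha' : ‖t * a‖ < 2 := by linarith
  have h := (hasSum_weightedLeft ha' hb hc).sub (hasSum_weightedRight ha' hb hc)
  rw [sumThree_double_shuffle ha' hb hc (fun h => hca (mul_left_cancel₀ ht h))
    (fun h => hcb (mul_left_cancel₀ ht h))] at h
  have h' := h.of_forall_eq fun n => mul_sub _ _ _
  generalize (t * c - t * a)⁻¹ = u at h'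
  generalize (t * c - t * b)⁻¹ = v at h'
  convert h' using 1
  ring

theorem mainTheorem9 :
    -- the generating function identity, with absolute convergence of every series in it
    (∀ x₁ x₂ x₃ : ℂ, ‖x₁‖ < 2 → ‖x₂‖ < 1 → ‖x₃‖ < 1 →
      ((∀ y ∈ ({![x₁ + x₃, x₁, x₂], ![x₁, x₁, x₂], ![x₁ + x₃, x₂ + x₃, x₂],
            ![x₃, x₂ + x₃, x₂], ![x₁, x₂, x₂], ![x₁ + x₃, x₂ + x₃, x₃],
            ![x₃, x₂ + x₃, x₃], ![x₁, x₂, x₃], ![x₁, x₃, x₂], ![x₃, x₁, x₂]} :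
            Set (Fin 3 → ℂ)), Summable (genTerm y)) ∧
        (∀ y ∈ ({![x₃, x₂], ![x₁, x₂], ![x₁, x₃]} : Set (Fin 2 → ℂ)),
          Summable (genTerm y)) ∧
        Summable (middleOneTerm x₁ x₂) ∧
        Summable (firstTwoTerm x₂) ∧
        Summable (lastOneTerm x₁)) ∧
      (x₁ ≠ 0 → x₂ ≠ 0 → x₃ ≠ 0 → x₃ ≠ x₁ → x₃ ≠ x₂ →
        genG ![x₁ + x₃, x₁, x₂] - genG ![x₁, x₁, x₂] + genG ![x₁ + x₃, x₂ + x₃, x₂]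
            - genG ![x₃, x₂ + x₃, x₂] - genG ![x₁, x₂, x₂]
            + genG ![x₁ + x₃, x₂ + x₃, x₃] - genG ![x₃, x₂ + x₃, x₃]
            - genG ![x₁, x₂, x₃] - genG ![x₁, x₃, x₂] - genG ![x₃, x₁, x₂]
          = 1 / (x₃ - x₁) * (genG ![x₃, x₂] - genG ![x₁, x₂])
            + 1 / (x₃ - x₂) * (genG ![x₁, x₃] - genG ![x₁, x₂])
            - 1 / x₁ * genG ![x₁, x₂] - 1 / x₃ * genG ![x₃, x₂] - 1 / x₂ * genG ![x₁, x₂]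
            - ∑' s, middleOneTerm x₁ x₂ s
            + ∑' s, firstTwoTerm x₂ s
            + 1 / x₂ * ∑' s, lastOneTerm x₁ s)) ∧
    -- the coefficient form
    (∀ (a b c : ℝ) (n : ℕ), 3 ≤ n → c ≠ a → c ≠ b →
      (∑ p ∈ weightTriples n,
        (let j := p.1
         let k := p.2.1
         let l := p.2.2
         ((a + c) ^ (j - 1) * a ^ k * b ^ l * c
            + a * (a + c) ^ (j - 1) * (b + c) ^ (k - 1) * (c * b ^ l + b * c ^ l)
            - a ^ (j + k - 1) * b ^ l * c
            - a ^ j * b ^ (k + l - 1) * c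
            - a * c ^ j * (b + c) ^ (k - 1) * (b ^ l + b * c ^ (l - 1))
            - a ^ j * b ^ k * c ^ l - a ^ j * c ^ k * b ^ l - c ^ j * a ^ k * b ^ l)
          * multiZeta ![j, k, l]))
      = (∑ p ∈ weightPairs n,
          (let j := p.1
           let k := p.2
           ((a * c ^ j - a ^ j * c) * b ^ k / (c - a)
              + a ^ j * (b * c ^ k - b ^ k * c) / (c - b)
              - a ^ (j - 1) * b ^ k * c - a * b ^ k * c ^ (j - 1) - a ^ j * b ^ (k - 1) * c)
            * multiZeta ![j, k]))
        - (∑ k ∈ Finset.Icc 2 (n - 2),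
            a ^ k * b ^ (n - 1 - k) * c * multiZeta ![k, 1, n - 1 - k])
        + a * b ^ (n - 2) * c * multiZeta ![2, n - 2]
        + a ^ (n - 1) * c * multiZeta ![n - 1, 1]) := by
  refine ⟨fun x₁ x₂ x₃ h₁ h₂ h₃ => ?_, fun a b c n hn hca hcb => ?_⟩
  · have h₁₃ : ‖x₁ + x₃‖ < 3 := (norm_add_le _ _).trans_lt (by linarith)
    have h₂₃ : ‖x₂ + x₃‖ < 2 := (norm_add_le _ _).trans_lt (by linarith)
    have g₁ : ‖x₁‖ < 3 := by linarith
    have g₂ : ‖x₂‖ < 2 := by linarith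
    have g₃ : ‖x₃‖ < 3 := by linarith
    have g₃' : ‖x₃‖ < 2 := by linarith
    have t1 := hasSum_genTerm_three h₁₃ h₁ h₂
    have t2 := hasSum_genTerm_three g₁ h₁ h₂
    have t3 := hasSum_genTerm_three h₁₃ h₂₃ h₂
    have t4 := hasSum_genTerm_three g₃ h₂₃ h₂
    have t5 := hasSum_genTerm_three g₁ g₂ h₂
    have t6 := hasSum_genTerm_three h₁₃ h₂₃ h₃
    have t7 := hasSum_genTerm_three g₃ h₂₃ h₃
    have t8 := hasSum_genTerm_three g₁ g₂ h₃
    have t9 := hasSum_genTerm_three g₁ g₃' h₂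
    have t10 := hasSum_genTerm_three g₃ h₁ h₂
    have d1 := hasSum_genTerm_two g₃' h₂
    have d2 := hasSum_genTerm_two h₁ h₂
    have d3 := hasSum_genTerm_two h₁ h₃
    have e1 := hasSum_middleOneTerm g₁ h₂
    have e2 := hasSum_firstTwoTerm h₂
    have e3 := hasSum_lastOneTerm h₁
    refine ⟨⟨?_, ?_, e1.summable, e2.summable, e3.summable⟩, fun n₁ n₂ n₃ h₃₁ h₃₂ => ?_⟩
    · rintro y (rfl | rfl | rfl | rfl | rfl | rfl | rfl | rfl | rfl | rfl)
      exacts [t1.summable, t2.summable, t3.summable, t4.summable, t5.summable, t6.summable,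
        t7.summable, t8.summable, t9.summable, t10.summable]
    · rintro y (rfl | rfl | rfl)
      exacts [d1.summable, d2.summable, d3.summable]
    · simp only [genG]
      rw [t1.tsum_eq, t2.tsum_eq, t3.tsum_eq, t4.tsum_eq, t5.tsum_eq, t6.tsum_eq, t7.tsum_eq,
        t8.tsum_eq, t9.tsum_eq, t10.tsum_eq, d1.tsum_eq, d2.tsum_eq, d3.tsum_eq, e1.tsum_eq,
        e2.tsum_eq, e3.tsum_eq]
      -- The double shuffle relation carries an extra factor `x₂`.
      apply mul_left_cancel₀ n₂
      rw [sumThree_double_shuffle h₁ h₂ h₃ h₃₁ h₃₂]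
      generalize hu : (x₃ - x₁)⁻¹ = u
      generalize hv : (x₃ - x₂)⁻¹ = v
      rw [one_div (x₃ - x₁), one_div (x₃ - x₂), hu, hv]
      field_simp
  · obtain ⟨m, rfl⟩ : ∃ m, n = m + 3 := ⟨n - 3, by omega⟩
    have h := weighted_sum_formula (a := a) (b := b) (c := c) (by exact_mod_cast hca)
      (by exact_mod_cast hcb) m
    simp only [tripleCoeff, weightedRight, pairCoeff] at h
    simp only [show m + 3 - 2 = m + 1 by omega, show m + 3 - 1 = m + 2 by omega]
    exact_mod_cast h
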